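/- Let $\mathbb{F}$ be a free group of finite rank $n$. A subgroup $A\le\mathbb{F}$ is a free factor if $\mathbb{F}=A*B$ for some subgroup $B\le\mathbb{F}$, called a complementary free factor; the corank of $A$ is the rank of any complementary free factor. The free factor complex $\mathcal{F}_n$ is the simplicial complex whose vertices are the conjugacy classes of nontrivial proper free factors of $\mathbb{F}$, where a nonempty finite set of vertices spans a simplex if it can be ordered as $[A_1],\dots,[A_k]$ with $A_1\subset A_2\subset\cdots\subset A_k$ up to conjugation. For a free factor $A$, let $\mathcal{F}^{\uparrow}(A)$ be the full subcomplex of $\mathcal{F}_n$ spanned by the vertices that properly contain $A$ up to conjugation. If the corank of $A$ is at least $3$, then $\mathcal{F}^{\uparrow}(A)$ is connected (in particular nonempty). -/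

import Mathlib

/-- `F = H * K`: the group `F` is the internal free product of its subgroups `H` and `K`, that is,
the canonical homomorphism from the free product `H ∗ K` to `F` is an isomorphism. -/
def IsInternalFreeProduct {F : Type*} [Group F] (H K : Subgroup F) : Prop :=
  Function.Bijective (Monoid.Coprod.lift H.subtype K.subtype)

/-- `H` is a free factor of `F` if it has a complementary free factor. The trivial subgroup and
the whole group are free factors in this sense. -/
def IsFreeFactor {F : Type*} [Group F] (H : Subgroup F) : Prop :=
  ∃ K : Subgroup F, IsInternalFreeProduct H K

/-- `A` is a free factor of corank `k`: it has a complementary free factor that is free of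
rank `k`. -/
def HasCorank {F : Type*} [Group F] (A : Subgroup F) (k : ℕ) : Prop :=
  ∃ B : Subgroup F, IsInternalFreeProduct A B ∧ Nonempty (FreeGroup (Fin k) ≃* B)

/-- Conjugacy of subgroups. -/
def subgroupConjSetoid (F : Type*) [Group F] : Setoid (Subgroup F) where
  r H K := ∃ g : F, H.map (MulAut.conj g).toMonoidHom = K
  iseqv :=
    { refl := fun H => ⟨1, by ext x; simp⟩
      symm := by
        rintro H _ ⟨g, rfl⟩
        refine ⟨g⁻¹, ?_⟩
        rw [Subgroup.map_map]
        ext x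
        simp [Subgroup.mem_map, mul_assoc]
      trans := by
        rintro H _ _ ⟨g, rfl⟩ ⟨h, rfl⟩
        refine ⟨h * g, ?_⟩
        rw [Subgroup.map_map]
        congr 1
        ext x
        simp [mul_assoc] }

/-- Conjugacy classes of subgroups of `F`. -/
def SubgroupConjClass (F : Type*) [Group F] : Type _ := Quotient (subgroupConjSetoid F)

/-- The conjugacy class of a subgroup. -/
def SubgroupConjClass.mk {F : Type*} [Group F] (H : Subgroup F) : SubgroupConjClass F :=
  Quotient.mk (subgroupConjSetoid F) H

/-- Vertices of the free factor complex: conjugacy classes of free factors of `F` that are neither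
trivial nor the whole group. -/
def FreeFactorVertex (F : Type*) [Group F] : Type _ :=
  {X : SubgroupConjClass F // ∃ H : Subgroup F,
    SubgroupConjClass.mk H = X ∧ IsFreeFactor H ∧ H ≠ ⊥ ∧ H ≠ ⊤}

/-- Inclusion up to conjugation. -/
def FreeFactorVertex.Incl {F : Type*} [Group F] (X Y : FreeFactorVertex F) : Prop :=
  ∃ H K : Subgroup F, SubgroupConjClass.mk H = X.1 ∧ SubgroupConjClass.mk K = Y.1 ∧ H ≤ K

/-- The free factor complex of `F`: the simplices are the nonempty finite sets of vertices that
form a chain for inclusion up to conjugation. -/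
def freeFactorComplex (F : Type*) [Group F] : AbstractSimplicialComplex (FreeFactorVertex F) where
  faces := {s | s.Nonempty ∧ IsChain FreeFactorVertex.Incl (s : Set (FreeFactorVertex F))}
  isRelLowerSet_faces := fun {_} hs =>
    ⟨hs.1, fun _ hts ht => ⟨ht, hs.2.mono (Finset.coe_subset.mpr hts)⟩⟩
  singleton_mem := fun v => ⟨Finset.singleton_nonempty v, by simp⟩

/-- `X` properly contains `A` up to conjugation. -/
def ProperlyContains {F : Type*} [Group F] (X : FreeFactorVertex F) (A : Subgroup F) : Prop :=
  ∃ H : Subgroup F, SubgroupConjClass.mk H = X.1 ∧ A < H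

/-- The upward link of `A`: the full subcomplex of the free factor complex spanned by the vertices
that properly contain `A` up to conjugation. -/
def upwardLink {F : Type*} [Group F] (A : Subgroup F) :
    PreAbstractSimplicialComplex (FreeFactorVertex F) where
  faces := {s | s ∈ (freeFactorComplex F).faces ∧ ∀ X ∈ s, ProperlyContains X A}
  isRelLowerSet_faces := fun {_} hs =>
    ⟨hs.1.1, fun _ hts ht =>
      ⟨((freeFactorComplex F).isRelLowerSet_faces hs.1).2 hts ht, fun X hX => hs.2 X (hts hX)⟩⟩

/-- The 1-skeleton of a simplicial complex, as a graph on its vertices. -/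
def oneSkeleton {V : Type*} (K : PreAbstractSimplicialComplex V) :
    SimpleGraph {v : V // {v} ∈ K.faces} where
  Adj u v := u ≠ v ∧ ∃ s ∈ K.faces, s.card = 2 ∧ u.1 ∈ s ∧ v.1 ∈ s
  symm := ⟨fun _ _ h => ⟨h.1.symm, h.2.imp fun _ hs => ⟨hs.1, hs.2.1, hs.2.2.2, hs.2.2.1⟩⟩⟩
  loopless := ⟨fun _ h => h.1 rfl⟩

/-- A simplicial complex is connected if it is nonempty and any two vertices are joined by an
edge path. -/
def IsConnectedComplex {V : Type*} (K : PreAbstractSimplicialComplex V) : Prop :=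
  (oneSkeleton K).Connected

/-!
A vertex of the upward link of `A` spanned by part of a basis extending a basis `S` of `A` is joined
to any other vertex spanned by part of the same basis: corank at least three allows the detour
`S ∪ {i} ⊂ S ∪ {i, j} ⊃ S ∪ {j}` through proper free factors. If two such bases differ only in the
member with index `i ∉ S`, then the remaining members span a common vertex, so the vertices spanned
by parts of either basis are joined as well.

Fix one basis `X` extending a basis of `A`. A free factor `H` containing `A` is spanned by part of a
basis `Y` that contains the basis of `A` up to inversion: members of `X` that lie in `H` have length
one, so they belong, up to inversion, to every Nielsen reduced basis of `H`. Nielsen reduction of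
`Y` changes one member at a time, leaves the members of length one alone, and ends in a Nielsen
reduced basis of the whole group, which is `X` up to inversion and order.
-/

namespace FreeFactorComplex

open FreeGroup (invRev reduce IsReduced)

section CommonPrefix

variable {β : Type*} [DecidableEq β]

/-- The length of the longest common prefix of two lists. -/
def lcpLength : List β → List β → ℕ
  | a :: l, b :: m => if a = b then lcpLength l m + 1 else 0
  | _, _ => 0

theorem le_lcpLength_iff {l m : List β} {n : ℕ} :
    n ≤ lcpLength l m ↔ n ≤ l.length ∧ n ≤ m.length ∧ l.take n = m.take n := by
  induction l generalizing m n with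
  | nil => cases n <;> simp [lcpLength]
  | cons a l ih =>
    rcases m with _ | ⟨b, m⟩ <;> rcases n with _ | n
    · simp
    · simp [lcpLength]
    · simp
    · by_cases h : a = b <;> simp [lcpLength, h, ih]

theorem lcpLength_le_left (l m : List β) : lcpLength l m ≤ l.length :=
  (le_lcpLength_iff.1 le_rfl).1

theorem lcpLength_le_right (l m : List β) : lcpLength l m ≤ m.length :=
  (le_lcpLength_iff.1 le_rfl).2.1

theorem take_lcpLength (l m : List β) : l.take (lcpLength l m) = m.take (lcpLength l m) :=
  (le_lcpLength_iff.1 le_rfl).2.2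

theorem lcpLength_comm (l m : List β) : lcpLength l m = lcpLength m l :=
  eq_of_forall_le_iff fun n => by simp only [le_lcpLength_iff, eq_comm, and_left_comm]

theorem min_lcpLength_le (k l m : List β) :
    min (lcpLength k l) (lcpLength l m) ≤ lcpLength k m := by
  obtain ⟨hk, _, hkl⟩ := le_lcpLength_iff.1 (min_le_left (lcpLength k l) (lcpLength l m))
  obtain ⟨_, hm, hlm⟩ := le_lcpLength_iff.1 (min_le_right (lcpLength k l) (lcpLength l m))
  exact le_lcpLength_iff.2 ⟨hk, hm, hkl.trans hlm⟩

end CommonPrefix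

section Cancellation

variable {α : Type*}

theorem invRev_drop (L : List (α × Bool)) (n : ℕ) :
    invRev (L.drop n) = (invRev L).take (L.length - n) := by
  simp only [invRev, List.take_reverse, List.map_drop, List.length_map]
  rw [List.reverse_inj, List.drop_eq_drop_iff, List.length_map]
  omega

theorem isReduced_invRev {L : List (α × Bool)} (h : IsReduced L) : IsReduced (invRev L) := by
  classical
  rw [FreeGroup.isReduced_iff_reduce_eq] at h ⊢
  rw [FreeGroup.reduce_invRev, h]

theorem isReduced_invRev_cons_append_cons {a b : α × Bool} {L M : List (α × Bool)}
    (hL : IsReduced (a :: L)) (hM : IsReduced (b :: M)) (hab : a ≠ b) :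
    IsReduced (invRev (a :: L) ++ b :: M) := by
  refine List.isChain_append.2 ⟨isReduced_invRev hL, hM, fun x hx y hy hxy => ?_⟩
  obtain rfl : (a.1, !a.2) = x := by simpa [invRev] using hx
  obtain rfl : b = y := by simpa using hy
  by_contra hsnd
  exact hab (Prod.ext hxy (by simpa using hsnd))

variable [DecidableEq α]

theorem reduce_invRev_append {L M : List (α × Bool)} (hL : IsReduced L) (hM : IsReduced M) :
    reduce (invRev L ++ M) = invRev (L.drop (lcpLength L M)) ++ M.drop (lcpLength L M) := by
  induction L generalizing M with
  | nil => simp [lcpLength, hM.reduce_eq]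
  | cons a L ih =>
    rcases M with _ | ⟨b, M⟩
    · simp [lcpLength, (isReduced_invRev hL).reduce_eq]
    by_cases hab : a = b
    · subst hab
      have hcancel : reduce (invRev (a :: L) ++ a :: M) = reduce (invRev L ++ M) := by
        apply FreeGroup.reduce.sound
        rw [← List.singleton_append, ← List.singleton_append (l := M)]
        simp only [← FreeGroup.mul_mk, ← FreeGroup.inv_mk]
        group
      rw [hcancel, ih (hL.infix ⟨[a], [], by simp⟩) (hM.infix ⟨[a], [], by simp⟩)]
      simp [lcpLength]
    · rw [(isReduced_invRev_cons_append_cons hL hM hab).reduce_eq]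
      simp [lcpLength, hab]

/-- The number of letters at the end of the reduced word of `x` that cancel in the product
`x * y`. -/
def cancellation (x y : FreeGroup α) : ℕ := lcpLength x⁻¹.toWord y.toWord

theorem cancellation_inv_inv (x y : FreeGroup α) : cancellation y⁻¹ x⁻¹ = cancellation x y := by
  rw [cancellation, inv_inv, lcpLength_comm, cancellation]

theorem cancellation_le_norm_left (x y : FreeGroup α) : cancellation x y ≤ x.norm :=
  (lcpLength_le_left _ _).trans_eq (FreeGroup.norm_inv_eq (x := x))

theorem cancellation_le_norm_right (x y : FreeGroup α) : cancellation x y ≤ y.norm :=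
  lcpLength_le_right _ _

/-- Common prefixes define an ultrametric: of three pairwise lengths the smallest occurs twice. -/
theorem cancellation_eq_of_lt {x y z : FreeGroup α} (h : cancellation x y < cancellation y⁻¹ z) :
    cancellation x z = cancellation x y := by
  have h₁ := min_lcpLength_le x⁻¹.toWord y.toWord z.toWord
  have h₂ := min_lcpLength_le x⁻¹.toWord z.toWord y.toWord
  rw [lcpLength_comm z.toWord] at h₂
  simp only [cancellation, inv_inv] at *
  omega

theorem toWord_mul_eq (x y : FreeGroup α) :
    (x * y).toWord =
      x.toWord.take (x.norm - cancellation x y) ++ y.toWord.drop (cancellation x y) := by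
  have h := reduce_invRev_append (FreeGroup.isReduced_toWord (x := x⁻¹))
    (FreeGroup.isReduced_toWord (x := y))
  rwa [invRev_drop, ← FreeGroup.toWord_inv, inv_inv, ← FreeGroup.toWord_mul,
    ← FreeGroup.norm, FreeGroup.norm_inv_eq] at h

theorem norm_mul_add_two_mul_cancellation (x y : FreeGroup α) :
    (x * y).norm + 2 * cancellation x y = x.norm + y.norm := by
  have hx := cancellation_le_norm_left x y
  have hy := cancellation_le_norm_right x y
  have hxy := congrArg List.length (toWord_mul_eq x y)
  rw [List.length_append, List.length_take, List.length_drop] at hxy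
  unfold FreeGroup.norm at *
  omega

theorem norm_lt_norm_mul_self {g : FreeGroup α} (hg : g ≠ 1) : g.norm < (g * g).norm := by
  set c := FreeGroup.reduceCyclically.conjugator g.toWord
  set r := FreeGroup.reduceCyclically g.toWord
  have hword : c ++ r ++ invRev c = g.toWord :=
    FreeGroup.reduceCyclically.conj_conjugator_reduceCyclically g.toWord
  have hsq : (g * g).toWord = c ++ (r ++ r) ++ invRev c := by
    rw [← pow_two, FreeGroup.toWord_pow,
      FreeGroup.reduceCyclically.reduce_flatten_replicate FreeGroup.isReduced_toWord]
    simp [c, r]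
  have hr : r ≠ [] := fun hr => hg <| by
    rw [← mul_eq_left (a := g), ← FreeGroup.toWord_inj, hsq, ← hword, hr, List.append_nil]
  have := List.length_pos_iff.2 hr
  simp only [FreeGroup.norm, hsq, ← hword, List.length_append]
  omega

theorem two_mul_cancellation_self_lt {g : FreeGroup α} (hg : g ≠ 1) :
    2 * cancellation g g < g.norm := by
  have := norm_mul_add_two_mul_cancellation g g
  have := norm_lt_norm_mul_self hg
  omega

end Cancellation

section Weight

variable {α : Type*} [Fintype α]

/-- A numerical code of a word, injective on the words of a given length. -/
noncomputable def code (L : List (α × Bool)) : ℕ :=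
  Nat.ofDigits (Fintype.card (α × Bool) + 2) (L.map fun a => (Fintype.equivFin (α × Bool) a : ℕ))

theorem code_append (L M : List (α × Bool)) :
    code (L ++ M) = code L + (Fintype.card (α × Bool) + 2) ^ L.length * code M := by
  simp [code, Nat.ofDigits_append]

theorem eq_of_code_eq {L M : List (α × Bool)} (hlen : L.length = M.length)
    (hcode : code L = code M) : L = M := by
  have digit_lt (N : List (α × Bool)) (d : ℕ)
      (hd : d ∈ N.map fun a => (Fintype.equivFin (α × Bool) a : ℕ)) :
      d < Fintype.card (α × Bool) + 2 := by
    obtain ⟨a, -, rfl⟩ := List.mem_map.1 hd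
    omega
  exact List.map_injective_iff.2 (Fin.val_injective.comp (Fintype.equivFin (α × Bool)).injective)
    (Nat.ofDigits_inj_of_len_eq (by omega) (by simpa using hlen) (digit_lt L) (digit_lt M) hcode)

/-- The sum of the codes of the initial halves of a word and of its formal inverse. -/
noncomputable def halfCode (L : List (α × Bool)) : ℕ :=
  code (L.take (L.length / 2)) + code ((invRev L).take (L.length / 2))

theorem halfCode_invRev (L : List (α × Bool)) : halfCode (invRev L) = halfCode L := by
  simp [halfCode, FreeGroup.invRev_invRev, add_comm]

theorem halfCode_append_lt {q r s : List (α × Bool)} (hlen : q.length = r.length)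
    (hs : r.length ≤ s.length) (hcode : code q < code r) :
    halfCode (q ++ s) < halfCode (r ++ s) := by
  have hhalf : (r.length + s.length) / 2 ≤ (invRev s).length := by
    rw [FreeGroup.invRev_length]
    omega
  have hr : r.length ≤ (r.length + s.length) / 2 := by omega
  simp only [halfCode, List.length_append, hlen, FreeGroup.invRev_append,
    List.take_append_of_le_length hhalf]
  rw [List.take_append, List.take_append, List.take_of_length_le (by omega),
    List.take_of_length_le hr, code_append, code_append, hlen]
  omega

variable [DecidableEq α]

/-- The quantity that decreases under Nielsen moves: the length, ties being broken by the code of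
the initial halves. -/
noncomputable def weight (g : FreeGroup α) : ℕ ×ₗ ℕ := toLex (g.norm, halfCode g.toWord)

theorem weight_inv (g : FreeGroup α) : weight g⁻¹ = weight g := by
  rw [weight, FreeGroup.norm_inv_eq, FreeGroup.toWord_inv, halfCode_invRev, weight]

theorem norm_le_of_weight_le {g h : FreeGroup α} (hgh : weight g ≤ weight h) : g.norm ≤ h.norm :=
  Prod.Lex.monotone_fst _ _ hgh

/-- The product `v * w` is obtained by replacing the initial part of `w` that cancels against the
second half of `v` by the first half of `v`. -/
theorem weight_mul_lt {v w : FreeGroup α} (hv : 2 * cancellation v w = v.norm)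
    (hw : 2 * cancellation v w ≤ w.norm)
    (hcode : code (v.toWord.take (cancellation v w)) < code (v⁻¹.toWord.take (cancellation v w))) :
    weight (v * w) < weight w := by
  have hnorm := norm_mul_add_two_mul_cancellation v w
  have hmul := toWord_mul_eq v w
  have hprefix := take_lcpLength v⁻¹.toWord w.toWord
  rw [← cancellation] at hprefix
  set l := cancellation v w
  have hw_eq : w.toWord = v⁻¹.toWord.take l ++ w.toWord.drop l := by
    rw [hprefix, List.take_append_drop]
  rw [show v.norm - l = l by omega] at hmul
  have hlt : halfCode (v * w).toWord < halfCode w.toWord := by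
    rw [hmul]
    conv_rhs => rw [hw_eq]
    have hw_length : w.toWord.length = w.norm := rfl
    exact halfCode_append_lt (by simp) (by simp; omega) hcode
  exact Prod.Lex.toLex_lt_toLex.2 (.inr ⟨by simp only; omega, hlt⟩)

end Weight

theorem exists_isChain_list_of_mem_closure {G : Type*} [Group G] {U : Set G}
    (hU : ∀ x ∈ U, x⁻¹ ∈ U) {g : G} (hg : g ∈ Subgroup.closure U) :
    ∃ L : List G, (∀ x ∈ L, x ∈ U) ∧ L.IsChain (· * · ≠ 1) ∧ L.prod = g := by
  have prepend (x : G) (hx : x ∈ U) (g : G)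
      (hg : ∃ L : List G, (∀ x ∈ L, x ∈ U) ∧ L.IsChain (· * · ≠ 1) ∧ L.prod = g) :
      ∃ L : List G, (∀ x ∈ L, x ∈ U) ∧ L.IsChain (· * · ≠ 1) ∧ L.prod = x * g := by
    obtain ⟨_ | ⟨y, L⟩, hLU, hchain, rfl⟩ := hg
    · exact ⟨[x], by simpa using hx, List.isChain_singleton x, by simp⟩
    by_cases hxy : x * y = 1
    · exact ⟨L, fun z hz => hLU z (.tail y hz), hchain.tail, by
        rw [List.prod_cons, ← mul_assoc, hxy, one_mul]⟩
    · exact ⟨x :: y :: L, List.forall_mem_cons.2 ⟨hx, hLU⟩, hchain.cons_cons hxy, List.prod_cons⟩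
  induction hg using Subgroup.closure_induction_left with
  | one => exact ⟨[], by simp, List.isChain_nil, rfl⟩
  | mul_left x hx g _ ih => exact prepend x hx g ih
  | inv_mul_cancel x hx g _ ih => exact prepend x⁻¹ (hU x hx) g ih

section NielsenReduced

variable {α : Type*} [DecidableEq α] {U : Set (FreeGroup α)}

theorem norm_pos_of_mem (hU : 1 ∉ U) {x : FreeGroup α} (hx : x ∈ U) : 0 < x.norm :=
  Nat.pos_of_ne_zero fun h => hU (FreeGroup.norm_eq_zero.1 h ▸ hx)

theorem two_mul_cancellation_le_right_of_left (hU : ∀ x ∈ U, x⁻¹ ∈ U)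
    (hleft : ∀ x ∈ U, ∀ y ∈ U, x * y ≠ 1 → 2 * cancellation x y ≤ x.norm) {x y : FreeGroup α}
    (hx : x ∈ U) (hy : y ∈ U) (hxy : x * y ≠ 1) : 2 * cancellation x y ≤ y.norm := by
  rw [← cancellation_inv_inv, ← FreeGroup.norm_inv_eq (x := y)]
  exact hleft _ (hU y hy) _ (hU x hx) (by rwa [← mul_inv_rev, inv_ne_one])

/-- Nielsen reduced sets, here assumed to be closed under inversion: in a product of two members
that are not mutually inverse at most half of either cancels, and in a product of three the middle
one does not cancel completely. Cancellation in the second factor is controlled by closure under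
inversion. -/
structure IsNielsenReduced (U : Set (FreeGroup α)) : Prop where
  inv_mem : ∀ x ∈ U, x⁻¹ ∈ U
  one_notMem : 1 ∉ U
  two_mul_cancellation_le : ∀ x ∈ U, ∀ y ∈ U, x * y ≠ 1 → 2 * cancellation x y ≤ x.norm
  cancellation_add_lt : ∀ x ∈ U, ∀ y ∈ U, ∀ z ∈ U, x * y ≠ 1 → y * z ≠ 1 →
    cancellation x y + cancellation y z < y.norm

namespace IsNielsenReduced

theorem cancellation_prod (hU : IsNielsenReduced U) {x y : FreeGroup α} {L : List (FreeGroup α)}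
    (hL : ∀ z ∈ x :: y :: L, z ∈ U) (hchain : (x :: y :: L).IsChain (· * · ≠ 1)) :
    cancellation x (y :: L).prod = cancellation x y ∧
      cancellation x y + (y :: L).length ≤ (y :: L).prod.norm := by
  induction L generalizing x y with
  | nil =>
    simp only [List.forall_mem_cons, List.isChain_cons_cons] at hL hchain
    have := two_mul_cancellation_le_right_of_left hU.inv_mem hU.two_mul_cancellation_le
      hL.1 hL.2.1 hchain.1
    have := norm_pos_of_mem hU.one_notMem hL.2.1
    simp only [List.prod_singleton, List.length_singleton, true_and]
    omega
  | cons z L ih =>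
    have hmiddle : cancellation x y + cancellation y z < y.norm := by
      simp only [List.forall_mem_cons, List.isChain_cons_cons] at hL hchain
      exact hU.cancellation_add_lt x hL.1 y hL.2.1 z hL.2.2.1 hchain.1 hchain.2.1
    obtain ⟨hcancel, hnorm⟩ := ih (fun w hw => hL w (.tail x hw)) hchain.tail
    rw [List.prod_cons, List.length_cons]
    set g := (z :: L).prod
    have hyg := norm_mul_add_two_mul_cancellation y g
    have hg := norm_mul_add_two_mul_cancellation y⁻¹ (y * g)
    rw [inv_mul_cancel_left, FreeGroup.norm_inv_eq] at hg
    exact ⟨cancellation_eq_of_lt (by omega), by omega⟩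

theorem length_le_norm_prod (hU : IsNielsenReduced U) {L : List (FreeGroup α)}
    (hL : ∀ z ∈ L, z ∈ U) (hchain : L.IsChain (· * · ≠ 1)) : L.length ≤ L.prod.norm := by
  rcases L with _ | ⟨y, L⟩
  · exact Nat.zero_le _
  have hy : y ∈ U := hL y List.mem_cons_self
  have hyy : y * y ≠ 1 := fun h => by
    have := norm_lt_norm_mul_self (g := y) fun hy1 => hU.one_notMem (hy1 ▸ hy)
    simp [h] at this
  have := (hU.cancellation_prod (List.forall_mem_cons.2 ⟨hy, hL⟩) (hchain.cons_cons hyy)).2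
  omega

theorem mem_of_mem_closure_of_norm_eq_one (hU : IsNielsenReduced U) {g : FreeGroup α}
    (hg : g ∈ Subgroup.closure U) (hnorm : g.norm = 1) : g ∈ U := by
  obtain ⟨L, hL, hchain, rfl⟩ := exists_isChain_list_of_mem_closure hU.inv_mem hg
  have hlength := hU.length_le_norm_prod hL hchain
  rcases L with _ | ⟨x, _ | ⟨y, L⟩⟩
  · simp at hnorm
  · simpa using hL
  · simp only [List.length_cons] at hlength
    omega

end IsNielsenReduced

variable [Fintype α]

/-- Sets closed under inversion in which no member `y` of length greater than one can be replaced
by a product `x * y` of smaller weight. The members of length one are left out so that they may be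
kept fixed in the reduction process. -/
structure IsNielsenMinimal (U : Set (FreeGroup α)) : Prop where
  inv_mem : ∀ x ∈ U, x⁻¹ ∈ U
  one_notMem : 1 ∉ U
  weight_le : ∀ x ∈ U, ∀ y ∈ U, 1 < y.norm → x ≠ y → x * y ≠ 1 → weight y ≤ weight (x * y)

namespace IsNielsenMinimal

theorem two_mul_cancellation_self_lt (hU : IsNielsenMinimal U) {x : FreeGroup α} (hx : x ∈ U) :
    2 * cancellation x x < x.norm :=
  FreeFactorComplex.two_mul_cancellation_self_lt fun h => hU.one_notMem (h ▸ hx)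

theorem two_mul_cancellation_le (hU : IsNielsenMinimal U) (x : FreeGroup α) (hx : x ∈ U)
    (y : FreeGroup α) (hy : y ∈ U) (hxy : x * y ≠ 1) : 2 * cancellation x y ≤ x.norm := by
  by_cases hne : x = y
  · subst hne
    exact (hU.two_mul_cancellation_self_lt hx).le
  have hmul := norm_mul_add_two_mul_cancellation x y
  by_cases hnorm : 1 < y.norm
  · have := norm_le_of_weight_le (hU.weight_le x hx y hy hnorm hne hxy)
    omega
  · have := cancellation_le_norm_right x y
    have := norm_pos_of_mem hU.one_notMem hx
    have : (x * y).norm ≠ 0 := mt FreeGroup.norm_eq_zero.1 hxy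
    omega

theorem code_take_inv_le (hU : IsNielsenMinimal U) {x y : FreeGroup α} (hx : x ∈ U) (hy : y ∈ U)
    (hxy : x * y ≠ 1) (hhalf : 2 * cancellation x y = x.norm) :
    code (x⁻¹.toWord.take (cancellation x y)) ≤ code (x.toWord.take (cancellation x y)) := by
  by_contra! hcode
  have hright := two_mul_cancellation_le_right_of_left hU.inv_mem hU.two_mul_cancellation_le
    hx hy hxy
  have hne : x ≠ y := by
    rintro rfl
    exact (hU.two_mul_cancellation_self_lt hx).ne hhalf
  have hnorm : 1 < y.norm := by
    have := norm_pos_of_mem hU.one_notMem hx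
    omega
  exact (hU.weight_le x hx y hy hnorm hne hxy).not_gt (weight_mul_lt hhalf hright hcode)

/-- If `y` cancelled completely, then both of its halves would have the same code as those of its
inverse. -/
theorem cancellation_add_lt (hU : IsNielsenMinimal U) {x y z : FreeGroup α} (hx : x ∈ U)
    (hy : y ∈ U) (hz : z ∈ U) (hxy : x * y ≠ 1) (hyz : y * z ≠ 1) :
    cancellation x y + cancellation y z < y.norm := by
  have hxy_le := two_mul_cancellation_le_right_of_left hU.inv_mem hU.two_mul_cancellation_le
    hx hy hxy
  have hyz_le := hU.two_mul_cancellation_le y hy z hz hyz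
  by_contra! hge
  have heq : cancellation y⁻¹ x⁻¹ = cancellation y z := by
    rw [cancellation_inv_inv]
    omega
  have hnorm_inv : y⁻¹.norm = y.norm := FreeGroup.norm_inv_eq
  have hle := hU.code_take_inv_le hy hz hyz (by omega)
  have hge := hU.code_take_inv_le (hU.inv_mem y hy) (hU.inv_mem x hx)
    (by rwa [← mul_inv_rev, inv_ne_one]) (by omega)
  rw [inv_inv, heq] at hge
  have hly : cancellation y z ≤ y.toWord.length := cancellation_le_norm_left y z
  have hly' : cancellation y z ≤ y⁻¹.toWord.length := hly.trans_eq hnorm_inv.symm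
  have htake := eq_of_code_eq (by simp [hly]) (hge.antisymm hle)
  have hself : cancellation y z ≤ cancellation y⁻¹ y⁻¹ := by
    rw [cancellation, cancellation, inv_inv]
    exact le_lcpLength_iff.2 ⟨hly, hly', htake⟩
  have := hU.two_mul_cancellation_self_lt (hU.inv_mem y hy)
  omega

theorem isNielsenReduced (hU : IsNielsenMinimal U) : IsNielsenReduced U where
  inv_mem := hU.inv_mem
  one_notMem := hU.one_notMem
  two_mul_cancellation_le := hU.two_mul_cancellation_le
  cancellation_add_lt _ hx _ hy _ hz := hU.cancellation_add_lt hx hy hz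

end IsNielsenMinimal

end NielsenReduced

section Families

variable {I J G H : Type*} [Group G] [Group H]

/-- The members of a family and their inverses. -/
def signedRange (Y : I → G) : Set G := {x | ∃ i, x = Y i ∨ x = (Y i)⁻¹}

theorem inv_mem_signedRange {Y : I → G} {x : G} (hx : x ∈ signedRange Y) :
    x⁻¹ ∈ signedRange Y := by
  obtain ⟨i, rfl | rfl⟩ := hx
  exacts [⟨i, .inr rfl⟩, ⟨i, .inl (inv_inv _)⟩]

theorem map_mem_signedRange_iff {f : G →* H} (hf : Function.Injective f) {Y : I → G} {x : G} :
    f x ∈ signedRange (f ∘ Y) ↔ x ∈ signedRange Y := by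
  simp only [signedRange, Set.mem_ofPred_eq, Function.comp_apply, ← map_inv, hf.eq_iff]

/-- The subgroup generated by the members of a family with index in `T`. -/
def spanOn (Y : I → G) (T : Set I) : Subgroup G := Subgroup.closure (Y '' T)

theorem mem_spanOn {Y : I → G} {T : Set I} {i : I} (hi : i ∈ T) : Y i ∈ spanOn Y T :=
  Subgroup.subset_closure ⟨i, hi, rfl⟩

theorem spanOn_mono (Y : I → G) {T T' : Set I} (h : T ⊆ T') : spanOn Y T ≤ spanOn Y T' :=
  Subgroup.closure_mono (Set.image_mono h)

theorem spanOn_le {Y : I → G} {T : Set I} {K : Subgroup G} (h : ∀ i ∈ T, Y i ∈ K) :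
    spanOn Y T ≤ K :=
  (Subgroup.closure_le K).2 (Set.image_subset_iff.2 h)

theorem spanOn_congr {Y Y' : I → G} {T : Set I} (h : ∀ i ∈ T, Y i = Y' i) :
    spanOn Y T = spanOn Y' T := by
  rw [spanOn, spanOn, Set.image_congr h]

theorem spanOn_image_eq {X : I → G} {Y : J → G} {S : Set I} {j : I → J}
    (h : ∀ a ∈ S, X a = Y (j a) ∨ X a = (Y (j a))⁻¹) : spanOn Y (j '' S) = spanOn X S := by
  have mem_iff (K : Subgroup G) (a : I) (ha : a ∈ S) : X a ∈ K ↔ Y (j a) ∈ K := by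
    rcases h a ha with h | h <;> simp [h]
  refine le_antisymm (spanOn_le ?_) (spanOn_le fun a ha => ?_)
  · rintro _ ⟨a, ha, rfl⟩
    exact (mem_iff _ a ha).1 (mem_spanOn ha)
  · exact (mem_iff _ a ha).2 (mem_spanOn ⟨a, ha, rfl⟩)

theorem hom_ext_spanOn {Y : I → G} {T : Set I} {φ ψ : spanOn Y T →* H}
    (h : ∀ i (hi : i ∈ T), φ ⟨Y i, mem_spanOn hi⟩ = ψ ⟨Y i, mem_spanOn hi⟩) : φ = ψ := by
  refine MonoidHom.eq_of_eqOn_dense (Subgroup.closure_closure_coe_preimage (k := Y '' T)) ?_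
  rintro ⟨_, _⟩ ⟨i, hi, rfl⟩
  exact h i hi

end Families

section Bases

variable {I J G H : Type*} [Group G] [Group H]

theorem lift_apply_self (b : FreeGroupBasis I G) (f : I → H) (i : I) : b.lift f (b i) = f i :=
  congrFun (b.lift.symm_apply_apply f) i

theorem spanOn_univ (b : FreeGroupBasis I G) : spanOn b Set.univ = ⊤ := by
  rw [spanOn, Set.image_univ, ← FreeGroup.range_lift_eq_closure, MonoidHom.range_eq_top]
  have hlift : FreeGroup.lift b = b.repr.symm.toMonoidHom :=
    FreeGroup.ext_hom _ _ fun _ => FreeGroup.lift_apply_of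
  rw [hlift]
  exact b.repr.symm.surjective

theorem mem_spanOn_iff (b : FreeGroupBasis I G) {T : Set I} {i : I} : b i ∈ spanOn b T ↔ i ∈ T := by
  classical
  refine ⟨fun h => ?_, mem_spanOn⟩
  by_contra hi
  let exponent : G →* Multiplicative ℤ := b.lift (Pi.mulSingle i (Multiplicative.ofAdd 1))
  have hle : spanOn b T ≤ exponent.ker := spanOn_le fun j hj => by
    have hji : j ≠ i := fun hji => hi (hji ▸ hj)
    rw [MonoidHom.mem_ker, lift_apply_self, Pi.mulSingle_eq_of_ne hji]
  have hmem := hle h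
  rw [MonoidHom.mem_ker, lift_apply_self, Pi.mulSingle_eq_same] at hmem
  exact one_ne_zero (Multiplicative.ofAdd.injective hmem)

theorem spanOn_le_spanOn_iff (b : FreeGroupBasis I G) {T T' : Set I} :
    spanOn b T ≤ spanOn b T' ↔ T ⊆ T' :=
  ⟨fun h _ hi => (mem_spanOn_iff b).1 (h (mem_spanOn hi)), spanOn_mono b⟩

theorem isInternalFreeProduct_spanOn (b : FreeGroupBasis I G) (T : Set I) :
    IsInternalFreeProduct (spanOn b T) (spanOn b Tᶜ) := by
  classical
  let toCoprod : G →* Monoid.Coprod (spanOn b T) (spanOn b Tᶜ) := b.lift fun i =>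
    if hi : i ∈ T then .inl ⟨b i, mem_spanOn hi⟩ else .inr ⟨b i, mem_spanOn hi⟩
  have left_inv : toCoprod.comp (Monoid.Coprod.lift (spanOn b T).subtype (spanOn b Tᶜ).subtype) =
      .id _ := by
    refine Monoid.Coprod.hom_ext (hom_ext_spanOn fun i hi => ?_) (hom_ext_spanOn fun i hi => ?_)
    · simp [toCoprod, lift_apply_self, hi, -FreeGroupBasis.lift_apply_apply]
    · simp [toCoprod, lift_apply_self, Set.notMem_of_mem_compl hi,
        -FreeGroupBasis.lift_apply_apply]
  have right_inv : (Monoid.Coprod.lift (spanOn b T).subtype (spanOn b Tᶜ).subtype).comp toCoprod =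
      .id G := by
    refine b.ext_hom _ _ fun i => ?_
    simp only [MonoidHom.comp_apply, toCoprod, lift_apply_self]
    split_ifs <;> simp
  exact Function.bijective_iff_has_inverse.2
    ⟨toCoprod, DFunLike.congr_fun left_inv, DFunLike.congr_fun right_inv⟩

/-- The union of bases of the factors is a basis of a free product. -/
def coprodBasis (b : FreeGroupBasis I G) (c : FreeGroupBasis J H) :
    FreeGroupBasis (I ⊕ J) (Monoid.Coprod G H) :=
  .ofRepr <| MonoidHom.toMulEquiv
    (Monoid.Coprod.lift (b.lift (FreeGroup.of ∘ Sum.inl)) (c.lift (FreeGroup.of ∘ Sum.inr)))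
    (FreeGroup.lift (Sum.elim (Monoid.Coprod.inl ∘ b) (Monoid.Coprod.inr ∘ c)))
    (Monoid.Coprod.hom_ext (b.ext_hom _ _ fun i => by simp) (c.ext_hom _ _ fun i => by simp))
    (FreeGroup.ext_hom _ _ (by rintro (i | i) <;> simp))

theorem coprodBasis_inl (b : FreeGroupBasis I G) (c : FreeGroupBasis J H) (i : I) :
    coprodBasis b c (.inl i) = Monoid.Coprod.inl (b i) :=
  FreeGroup.lift_apply_of (f := Sum.elim (Monoid.Coprod.inl ∘ b) (Monoid.Coprod.inr ∘ c))
    (x := .inl i)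

/-- The union of bases of the factors is a basis of an internal free product. -/
noncomputable def internalFreeProductBasis {K L : Subgroup G} (h : IsInternalFreeProduct K L)
    (b : FreeGroupBasis I K) (c : FreeGroupBasis J L) : FreeGroupBasis (I ⊕ J) G :=
  (coprodBasis b c).map (MulEquiv.ofBijective _ h)

theorem internalFreeProductBasis_inl {K L : Subgroup G} (h : IsInternalFreeProduct K L)
    (b : FreeGroupBasis I K) (c : FreeGroupBasis J L) (i : I) :
    internalFreeProductBasis h b c (.inl i) = b i := by
  rw [internalFreeProductBasis, FreeGroupBasis.map_apply, coprodBasis_inl]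
  exact Monoid.Coprod.lift_apply_inl K.subtype L.subtype (b i)

theorem spanOn_internalFreeProductBasis {K L : Subgroup G} (h : IsInternalFreeProduct K L)
    (b : FreeGroupBasis I K) (c : FreeGroupBasis J L) :
    spanOn (internalFreeProductBasis h b c) (Set.range Sum.inl) = K := by
  have himage : internalFreeProductBasis h b c '' Set.range Sum.inl =
      K.subtype '' (b '' Set.univ) := by
    rw [← Set.range_comp, Set.image_univ, ← Set.range_comp]
    exact congrArg Set.range (funext (internalFreeProductBasis_inl h b c))
  rw [spanOn, himage, ← MonoidHom.map_closure, ← spanOn, spanOn_univ, ← MonoidHom.range_eq_map,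
    Subgroup.range_subtype]

theorem exists_basis_mul_mul (b : FreeGroupBasis I G) {i : I} {u v : G}
    (hu : u ∈ spanOn b {i}ᶜ) (hv : v ∈ spanOn b {i}ᶜ) :
    ∃ b' : FreeGroupBasis I G, (∀ k ≠ i, b' k = b k) ∧ b' i = u * b i * v := by
  classical
  let transvection (u v : G) : G →* G := b.lift (Function.update b i (u * b i * v))
  have apply_of_ne (u v : G) (k : I) (hk : k ≠ i) : transvection u v (b k) = b k := by
    rw [lift_apply_self, Function.update_of_ne hk]
  have apply_self (u v : G) : transvection u v (b i) = u * b i * v := by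
    rw [lift_apply_self, Function.update_self]
  have apply_of_mem (u v w : G) (hw : w ∈ spanOn b {i}ᶜ) : transvection u v w = w := by
    refine MonoidHom.eqOn_closure (g := .id G) ?_ hw
    rintro _ ⟨k, hk, rfl⟩
    exact apply_of_ne u v k hk
  have comp_inv (u v : G) (hu : u ∈ spanOn b {i}ᶜ) (hv : v ∈ spanOn b {i}ᶜ) :
      (transvection u⁻¹ v⁻¹).comp (transvection u v) = .id G := by
    refine b.ext_hom _ _ fun k => ?_
    rw [MonoidHom.comp_apply, MonoidHom.id_apply]
    obtain rfl | hk := eq_or_ne k i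
    · rw [apply_self, map_mul, map_mul, apply_self, apply_of_mem _ _ u hu, apply_of_mem _ _ v hv]
      group
    · rw [apply_of_ne u v k hk, apply_of_ne _ _ k hk]
  refine ⟨b.map ((transvection u v).toMulEquiv (transvection u⁻¹ v⁻¹) (comp_inv u v hu hv) ?_),
    apply_of_ne u v, apply_self u v⟩
  simpa only [inv_inv] using comp_inv u⁻¹ v⁻¹ (inv_mem hu) (inv_mem hv)

end Bases

section NielsenReduction

variable {α I G : Type*} [Group G]

/-- Two bases that differ in at most one member, whose index is not in `S`. -/
def IsExchange (S : Set I) (b b' : FreeGroupBasis I G) : Prop := ∃ i ∉ S, ∀ k ≠ i, b' k = b k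

theorem apply_eq_of_reflTransGen {S : Set I} {b b' : FreeGroupBasis I G}
    (h : Relation.ReflTransGen (IsExchange S) b b') {i : I} (hi : i ∈ S) : b' i = b i := by
  induction h with
  | refl => rfl
  | tail _ h ih =>
    obtain ⟨k, hk, heq⟩ := h
    rw [heq i (fun hik => hk (hik ▸ hi)), ih]

theorem exists_basis_mul (b : FreeGroupBasis I G) {i : I} {x y : G} (hx : x ∈ spanOn b {i}ᶜ)
    (hy : y = b i ∨ y = (b i)⁻¹) :
    ∃ b' : FreeGroupBasis I G, (∀ k ≠ i, b' k = b k) ∧ (b' i = x * y ∨ b' i = (x * y)⁻¹) := by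
  rcases hy with rfl | rfl
  · obtain ⟨b', hne, hi⟩ := exists_basis_mul_mul b hx (one_mem _)
    exact ⟨b', hne, .inl (by rw [hi, mul_one])⟩
  · obtain ⟨b', hne, hi⟩ := exists_basis_mul_mul b (one_mem _) (inv_mem hx)
    exact ⟨b', hne, .inr (by rw [hi, one_mul, mul_inv_rev, inv_inv])⟩

variable [DecidableEq α] {f : G →* FreeGroup α} {b : FreeGroupBasis I G} {S : Set I}

theorem weight_le_weight_mul_of_forall_isExchange [Fintype α] [Fintype I]
    (hmin : ∀ b', IsExchange S b b' → ∑ i, weight (f (b i)) ≤ ∑ i, weight (f (b' i))) {i : I}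
    (hi : i ∉ S) {x y : G} (hx : x ∈ spanOn b {i}ᶜ) (hy : y = b i ∨ y = (b i)⁻¹) :
    weight (f y) ≤ weight (f (x * y)) := by
  have weight_eq {u v : G} (h : u = v ∨ u = v⁻¹) : weight (f u) = weight (f v) := by
    rcases h with rfl | rfl <;> simp only [map_inv, weight_inv]
  obtain ⟨b', hne, hb'⟩ := exists_basis_mul b hx hy
  rw [weight_eq hy, ← weight_eq hb']
  by_contra! hlt
  refine (hmin b' ⟨i, hi, hne⟩).not_gt <|
    Finset.sum_lt_sum (fun k _ => ?_) ⟨i, Finset.mem_univ i, hlt⟩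
  obtain rfl | hk := eq_or_ne k i
  exacts [hlt.le, by rw [hne k hk]]

theorem isNielsenMinimal_of_forall_isExchange [Fintype α] [Fintype I] (hf : Function.Injective f)
    (hS : ∀ i ∈ S, (f (b i)).norm = 1)
    (hmin : ∀ b', IsExchange S b b' → ∑ i, weight (f (b i)) ≤ ∑ i, weight (f (b' i))) :
    IsNielsenMinimal (signedRange (f ∘ b)) where
  inv_mem _ := inv_mem_signedRange
  one_notMem := by
    rw [← map_one f, map_mem_signedRange_iff hf]
    rintro ⟨i, hi⟩
    have hbi : b i = 1 := by simpa [eq_comm] using hi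
    exact FreeGroup.of_ne_one i (by rw [← b.repr_apply_coe, hbi, map_one])
  weight_le := by
    have exists_preimage {i : I} {z : FreeGroup α} (hz : z = f (b i) ∨ z = (f (b i))⁻¹) :
        ∃ y, (y = b i ∨ y = (b i)⁻¹) ∧ f y = z := by
      rcases hz with rfl | rfl
      exacts [⟨_, .inl rfl, rfl⟩, ⟨_, .inr rfl, map_inv f _⟩]
    rintro _ ⟨j, hxj⟩ _ ⟨i, hyi⟩ hnorm hne hmul
    obtain ⟨x, hx, rfl⟩ := exists_preimage hxj
    obtain ⟨y, hy, rfl⟩ := exists_preimage hyi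
    have hji : j ≠ i := by
      rintro rfl
      rcases hx with rfl | rfl <;> rcases hy with rfl | rfl <;> simp at hne hmul
    have hiS : i ∉ S := fun hiS => by
      have hone : (f y).norm = 1 := by
        rcases hy with rfl | rfl <;> simp only [map_inv, FreeGroup.norm_inv_eq, hS i hiS]
      omega
    have hxspan : x ∈ spanOn b {i}ᶜ := by
      rcases hx with rfl | rfl
      exacts [mem_spanOn hji, inv_mem (mem_spanOn hji)]
    rw [← map_mul]
    exact weight_le_weight_mul_of_forall_isExchange hmin hiS hxspan hy

/-- Nielsen's theorem: among the bases that can be reached, take one of minimal total weight. -/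
theorem exists_reflTransGen_isNielsenReduced [Finite α] [Finite I] (hf : Function.Injective f)
    (b : FreeGroupBasis I G) (hS : ∀ i ∈ S, (f (b i)).norm = 1) :
    ∃ b', Relation.ReflTransGen (IsExchange S) b b' ∧ IsNielsenReduced (signedRange (f ∘ b')) := by
  have := Fintype.ofFinite α
  have := Fintype.ofFinite I
  obtain ⟨b', hreach, hmin⟩ := exists_minimalFor_of_wellFoundedLT
    (Relation.ReflTransGen (IsExchange S) b) (fun b' => ∑ i, weight (f (b' i))) ⟨b, .refl⟩
  refine ⟨b', hreach, IsNielsenMinimal.isNielsenReduced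
    (isNielsenMinimal_of_forall_isExchange hf (S := S) (fun i hi => ?_) fun b'' h => ?_)⟩
  · rw [apply_eq_of_reflTransGen hreach hi, hS i hi]
  · exact (le_total _ _).elim id (hmin (hreach.tail h))

theorem mem_signedRange_of_norm_eq_one (hf : Function.Injective f)
    (hb : IsNielsenReduced (signedRange (f ∘ b))) {g : G} (hg : (f g).norm = 1) :
    g ∈ signedRange b := by
  rw [← map_mem_signedRange_iff hf]
  refine hb.mem_of_mem_closure_of_norm_eq_one ?_ hg
  have hle : spanOn b Set.univ ≤ (Subgroup.closure (signedRange (f ∘ b))).comap f :=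
    spanOn_le fun i _ => Subgroup.subset_closure ⟨i, .inl rfl⟩
  exact hle (spanOn_univ b ▸ Subgroup.mem_top g)

end NielsenReduction

section Link

variable {F F' : Type*} [Group F] [Group F']

theorem isInternalFreeProduct_map {H K : Subgroup F} (h : IsInternalFreeProduct H K)
    (φ : F ≃* F') : IsInternalFreeProduct (H.map φ.toMonoidHom) (K.map φ.toMonoidHom) := by
  let e := MulEquiv.coprodCongr (H.equivMapOfInjective φ.toMonoidHom φ.injective)
    (K.equivMapOfInjective φ.toMonoidHom φ.injective)
  have hcomp : (Monoid.Coprod.lift (H.map φ.toMonoidHom).subtype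
      (K.map φ.toMonoidHom).subtype).comp e.toMonoidHom =
        φ.toMonoidHom.comp (Monoid.Coprod.lift H.subtype K.subtype) :=
    Monoid.Coprod.hom_ext rfl rfl
  have hbij : Function.Bijective (φ.toMonoidHom.comp (Monoid.Coprod.lift H.subtype K.subtype)) :=
    φ.bijective.comp h
  rw [← hcomp] at hbij
  exact (Function.Bijective.of_comp_iff _ e.bijective).1 hbij

theorem isFreeFactor_map {H : Subgroup F} (hH : IsFreeFactor H) (φ : F ≃* F') :
    IsFreeFactor (H.map φ.toMonoidHom) :=
  hH.elim fun _ hK => ⟨_, isInternalFreeProduct_map hK φ⟩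

/-- A proper free factor that properly contains `A`: a representative of a vertex of the upward
link of `A`. -/
structure IsLinkFactor (A H : Subgroup F) : Prop where
  isFreeFactor : IsFreeFactor H
  lt : A < H
  ne_top : H ≠ ⊤

variable {A H K L : Subgroup F}

/-- The vertex of the upward link of `A` represented by `H`. -/
def linkVertex (h : IsLinkFactor A H) : {v : FreeFactorVertex F // {v} ∈ (upwardLink A).faces} :=
  ⟨⟨SubgroupConjClass.mk H, H, rfl, h.isFreeFactor, h.lt.ne_bot, h.ne_top⟩,
    (freeFactorComplex F).singleton_mem _, fun _ hX => by
      rw [Finset.mem_singleton.1 hX]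
      exact ⟨H, rfl, h.lt⟩⟩

theorem exists_eq_linkVertex (v : {v : FreeFactorVertex F // {v} ∈ (upwardLink A).faces}) :
    ∃ (H : Subgroup F) (h : IsLinkFactor A H), v = linkVertex h := by
  obtain ⟨v, hv⟩ := v
  obtain ⟨H, hHv, hlt⟩ := hv.2 v (Finset.mem_singleton_self v)
  obtain ⟨K, hKv, hK, -, hKtop⟩ := v.2
  obtain ⟨g, rfl⟩ : ∃ g : F, K.map (MulAut.conj g).toMonoidHom = H :=
    Quotient.exact (hKv.trans hHv.symm)
  refine ⟨_, ⟨isFreeFactor_map hK _, hlt, fun htop => hKtop ?_⟩, Subtype.ext (Subtype.ext hHv.symm)⟩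
  refine Subgroup.map_injective (MulAut.conj g).injective (htop.trans ?_)
  exact (Subgroup.map_top_of_surjective _ (MulAut.conj g).surjective).symm

/-- `H` and `K` represent vertices of the upward link of `A` that are joined by an edge path. -/
def AreJoined (A H K : Subgroup F) : Prop :=
  ∃ (hH : IsLinkFactor A H) (hK : IsLinkFactor A K),
    (oneSkeleton (upwardLink A)).Reachable (linkVertex hH) (linkVertex hK)

theorem AreJoined.symm (h : AreJoined A H K) : AreJoined A K H :=
  let ⟨hH, hK, hHK⟩ := h
  ⟨hK, hH, hHK.symm⟩

theorem AreJoined.trans (h : AreJoined A H K) (h' : AreJoined A K L) : AreJoined A H L :=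
  let ⟨hH, _, hHK⟩ := h
  let ⟨_, hL, hKL⟩ := h'
  ⟨hH, hL, hHK.trans hKL⟩

theorem areJoined_of_le (hH : IsLinkFactor A H) (hK : IsLinkFactor A K) (hle : H ≤ K) :
    AreJoined A H K := by
  classical
  refine ⟨hH, hK, ?_⟩
  by_cases heq : linkVertex hH = linkVertex hK
  · rw [heq]
  refine SimpleGraph.Adj.reachable ⟨heq, {(linkVertex hH).1, (linkVertex hK).1},
    ⟨⟨Finset.insert_nonempty _ _, ?_⟩, ?_⟩, Finset.card_pair (Subtype.coe_ne_coe.2 heq),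
    Finset.mem_insert_self _ _, Finset.mem_insert_of_mem (Finset.mem_singleton_self _)⟩
  · rw [Finset.coe_pair]
    exact IsChain.pair ⟨H, K, rfl, rfl, hle⟩
  · intro X hX
    rw [Finset.mem_insert, Finset.mem_singleton] at hX
    rcases hX with rfl | rfl
    exacts [⟨H, rfl, hH.lt⟩, ⟨K, rfl, hK.lt⟩]

end Link

section Connectivity

variable {I F : Type*} [Group F] {b b' : FreeGroupBasis I F} {S T T' : Set I}

theorem isLinkFactor_spanOn_iff :
    IsLinkFactor (spanOn b S) (spanOn b T) ↔ S ⊂ T ∧ T ≠ Set.univ := by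
  have hlt : spanOn b S < spanOn b T ↔ S ⊂ T := by
    rw [lt_iff_le_not_ge, Set.ssubset_def, spanOn_le_spanOn_iff, spanOn_le_spanOn_iff]
  have htop : spanOn b T = ⊤ ↔ T = Set.univ := by
    rw [← top_le_iff, ← spanOn_univ b, spanOn_le_spanOn_iff, Set.univ_subset_iff]
  exact ⟨fun h => ⟨hlt.1 h.lt, htop.not.1 h.ne_top⟩, fun h =>
    ⟨⟨_, isInternalFreeProduct_spanOn b T⟩, hlt.2 h.1, htop.not.2 h.2⟩⟩

theorem insert_insert_ne_univ (hS : 3 ≤ Sᶜ.encard) (i j : I) :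
    insert i (insert j S) ≠ Set.univ := by
  intro huniv
  have hsub : Sᶜ ⊆ {i, j} := fun k hk => by
    have hmem : k ∈ insert i (insert j S) := huniv ▸ Set.mem_univ k
    simpa [show k ∉ S from hk] using hmem
  have hpair : ({i, j} : Set I).encard ≤ 2 := by
    simpa [Set.encard_singleton, one_add_one_eq_two] using Set.encard_insert_le {j} i
  exact absurd (hS.trans ((Set.encard_le_encard hsub).trans hpair)) (by decide)

theorem exists_isLinkFactor_spanOn (b : FreeGroupBasis I F) (hS : 3 ≤ Sᶜ.encard) :
    ∃ T, IsLinkFactor (spanOn b S) (spanOn b T) := by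
  obtain ⟨i, hi⟩ : Sᶜ.Nonempty := Set.encard_pos.1 (lt_of_lt_of_le (by decide) hS)
  refine ⟨insert i S, isLinkFactor_spanOn_iff.2 ⟨Set.ssubset_insert hi, ?_⟩⟩
  simpa using insert_insert_ne_univ hS i i

theorem areJoined_spanOn (hS : 3 ≤ Sᶜ.encard) (hT : IsLinkFactor (spanOn b S) (spanOn b T))
    (hT' : IsLinkFactor (spanOn b S) (spanOn b T')) :
    AreJoined (spanOn b S) (spanOn b T) (spanOn b T') := by
  obtain ⟨i, hiS, hiT⟩ := Set.ssubset_iff_insert.1 (isLinkFactor_spanOn_iff.1 hT).1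
  obtain ⟨j, hjS, hjT'⟩ := Set.ssubset_iff_insert.1 (isLinkFactor_spanOn_iff.1 hT').1
  have hij : IsLinkFactor (spanOn b S) (spanOn b (insert i (insert j S))) :=
    isLinkFactor_spanOn_iff.2 ⟨(Set.ssubset_insert hjS).trans_subset (Set.subset_insert _ _),
      insert_insert_ne_univ hS i j⟩
  have areJoined_insert (k : I) (hk : k ∉ S) (U : Set I) (hkU : insert k S ⊆ U)
      (hU : IsLinkFactor (spanOn b S) (spanOn b U)) :
      AreJoined (spanOn b S) (spanOn b (insert k S)) (spanOn b U) := by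
    refine areJoined_of_le (isLinkFactor_spanOn_iff.2 ⟨Set.ssubset_insert hk, fun huniv => ?_⟩) hU
      (spanOn_mono b hkU)
    exact (isLinkFactor_spanOn_iff.1 hU).2 (Set.univ_subset_iff.1 (huniv ▸ hkU))
  exact (areJoined_insert i hiS T hiT hT).symm.trans <|
    (areJoined_insert i hiS _ (Set.insert_subset_insert (Set.subset_insert _ _)) hij).trans <|
    (areJoined_insert j hjS _ (Set.subset_insert _ _) hij).symm.trans <|
    areJoined_insert j hjS T' hjT' hT'

theorem spanOn_eq_of_reflTransGen (h : Relation.ReflTransGen (IsExchange S) b b') :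
    spanOn b' S = spanOn b S :=
  spanOn_congr fun _ hi => apply_eq_of_reflTransGen h hi

theorem IsExchange.areJoined (h : IsExchange S b b') (hS : 3 ≤ Sᶜ.encard)
    (hT : IsLinkFactor (spanOn b S) (spanOn b T))
    (hT' : IsLinkFactor (spanOn b S) (spanOn b' T')) :
    AreJoined (spanOn b S) (spanOn b T) (spanOn b' T') := by
  have hspan : spanOn b' S = spanOn b S := spanOn_eq_of_reflTransGen (.single h)
  obtain ⟨i, hi, heq⟩ := h
  have hcommon : spanOn b' {i}ᶜ = spanOn b {i}ᶜ := spanOn_congr heq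
  have hlink : IsLinkFactor (spanOn b S) (spanOn b {i}ᶜ) := by
    refine isLinkFactor_spanOn_iff.2 ⟨?_, by simp⟩
    refine (Set.subset_compl_singleton_iff.2 hi).ssubset_of_ne fun hSi => ?_
    rw [hSi, compl_compl, Set.encard_singleton] at hS
    exact absurd hS (by decide)
  refine (areJoined_spanOn hS hT hlink).trans ?_
  rw [← hcommon, ← hspan] at hlink ⊢
  exact areJoined_spanOn hS hlink (hspan ▸ hT')

theorem areJoined_of_reflTransGen (h : Relation.ReflTransGen (IsExchange S) b b')
    (hS : 3 ≤ Sᶜ.encard) (hT : IsLinkFactor (spanOn b S) (spanOn b T))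
    (hT' : IsLinkFactor (spanOn b S) (spanOn b' T')) :
    AreJoined (spanOn b S) (spanOn b T) (spanOn b' T') := by
  induction h generalizing T' with
  | refl => exact areJoined_spanOn hS hT hT'
  | @tail b₁ _ hreach hstep ih =>
    obtain ⟨T₁, hT₁⟩ := exists_isLinkFactor_spanOn b₁ hS
    have hjoined := hstep.areJoined hS (T' := T') hT₁
    rw [spanOn_eq_of_reflTransGen hreach] at hT₁ hjoined
    exact (ih hT₁).trans (hjoined hT')

end Connectivity

section Assembly

variable {α F : Type*} [Group F] {S : Set α}

theorem norm_repr_apply [DecidableEq α] (X : FreeGroupBasis α F) (a : α) :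
    (X.repr (X a)).norm = 1 := by
  rw [X.repr_apply_coe, FreeGroup.norm_of]

theorem exists_spanOn_eq_of_forall_mem_signedRange {X Y : FreeGroupBasis α F}
    (h : ∀ a, X a ∈ signedRange Y) (T : Set α) : ∃ T', spanOn X T' = spanOn Y T := by
  choose j hj using h
  have hsurj : Function.Surjective j := by
    rw [← Set.range_eq_univ, ← Set.univ_subset_iff, ← Set.image_univ, ← spanOn_le_spanOn_iff Y,
      spanOn_image_eq (X := X) fun a _ => hj a, spanOn_univ, spanOn_univ]
  refine ⟨j ⁻¹' T, ?_⟩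
  rw [← spanOn_image_eq fun a _ => hj a, Set.image_preimage_eq T hsurj]

variable [Finite α]

theorem encard_compl_le_encard_compl_image (S : Set α) (j : α → α) :
    Sᶜ.encard ≤ (j '' S)ᶜ.encard := by
  refine (ENat.add_le_add_iff_left (Set.encard_ne_top_iff.2 S.toFinite)).1 ?_
  calc S.encard + Sᶜ.encard = (j '' S).encard + (j '' S)ᶜ.encard := by
        rw [Set.encard_add_encard_compl, Set.encard_add_encard_compl]
    _ ≤ S.encard + (j '' S)ᶜ.encard := add_le_add_left (Set.encard_image_le j S) _

theorem exists_basis_spanOn_eq (X : FreeGroupBasis α F) {H : Subgroup F} (hH : IsFreeFactor H)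
    (hS : spanOn X S ≤ H) :
    ∃ (Y : FreeGroupBasis α F) (T : Set α), (∀ a ∈ S, X a ∈ signedRange Y) ∧ spanOn Y T = H := by
  classical
  obtain ⟨C, hC⟩ := hH
  have := X.isFreeGroup
  let b := IsFreeGroup.basis H
  let c := IsFreeGroup.basis C
  let e : α ≃ IsFreeGroup.Generators H ⊕ IsFreeGroup.Generators C :=
    Equiv.ofFreeGroupEquiv (X.repr.symm.trans (internalFreeProductBasis hC b c).repr)
  have : Finite (IsFreeGroup.Generators H ⊕ IsFreeGroup.Generators C) := .of_equiv α e
  have : Finite (IsFreeGroup.Generators H) := .sum_left (IsFreeGroup.Generators C)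
  let f : H →* FreeGroup α := X.repr.toMonoidHom.comp H.subtype
  have hf : Function.Injective f := X.repr.injective.comp H.subtype_injective
  obtain ⟨b', -, hred⟩ := exists_reflTransGen_isNielsenReduced hf b (S := ∅) (by simp)
  let Z := internalFreeProductBasis hC b' c
  refine ⟨Z.reindex e.symm, e.symm '' Set.range Sum.inl, fun a ha => ?_, ?_⟩
  · obtain ⟨i, hi⟩ := mem_signedRange_of_norm_eq_one hf hred
      (g := ⟨X a, hS (mem_spanOn ha)⟩) (norm_repr_apply X a)
    refine ⟨e.symm (.inl i), ?_⟩
    simpa [Z, Subtype.ext_iff, internalFreeProductBasis_inl] using hi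
  · calc spanOn (Z.reindex e.symm) (e.symm '' Set.range Sum.inl)
      _ = spanOn Z (Set.range Sum.inl) := spanOn_image_eq fun i _ => .inl (by simp)
      _ = H := spanOn_internalFreeProductBasis hC b' c

theorem exists_areJoined_spanOn (X : FreeGroupBasis α F) (hS : 3 ≤ Sᶜ.encard) {H : Subgroup F}
    (hH : IsLinkFactor (spanOn X S) H) : ∃ T, AreJoined (spanOn X S) H (spanOn X T) := by
  classical
  obtain ⟨Y, T, hXY, rfl⟩ := exists_basis_spanOn_eq X hH.isFreeFactor hH.lt.le
  have : Nonempty α := (Set.encard_pos.1 (lt_of_lt_of_le (by decide) hS)).to_type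
  choose! j hj using hXY
  have hspan : spanOn Y (j '' S) = spanOn X S := spanOn_image_eq hj
  have hS' : 3 ≤ (j '' S)ᶜ.encard := hS.trans (encard_compl_le_encard_compl_image S j)
  have norm_eq_one : ∀ i ∈ j '' S, (X.repr (Y i)).norm = 1 := by
    rintro _ ⟨a, ha, rfl⟩
    have hnorm := norm_repr_apply X a
    rcases hj a ha with h | h <;> simpa only [h, map_inv, FreeGroup.norm_inv_eq] using hnorm
  obtain ⟨Y', hreach, hred⟩ :=
    exists_reflTransGen_isNielsenReduced (f := X.repr.toMonoidHom) X.repr.injective Y norm_eq_one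
  obtain ⟨T', hT'⟩ := exists_isLinkFactor_spanOn Y' hS'
  obtain ⟨U, hU⟩ := exists_spanOn_eq_of_forall_mem_signedRange (X := X) (Y := Y')
    (fun a => mem_signedRange_of_norm_eq_one X.repr.injective hred (norm_repr_apply X a)) T'
  rw [spanOn_eq_of_reflTransGen hreach] at hT'
  rw [← hspan] at hH ⊢
  exact ⟨U, hU ▸ areJoined_of_reflTransGen hreach hS' hH hT'⟩

theorem isConnectedComplex_upwardLink_spanOn (X : FreeGroupBasis α F) (hS : 3 ≤ Sᶜ.encard) :
    IsConnectedComplex (upwardLink (spanOn X S)) := by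
  obtain ⟨T, hT⟩ := exists_isLinkFactor_spanOn X hS
  refine (SimpleGraph.connected_iff _).2 ⟨fun v w => ?_, ⟨linkVertex hT⟩⟩
  obtain ⟨H, hH, rfl⟩ := exists_eq_linkVertex v
  obtain ⟨K, hK, rfl⟩ := exists_eq_linkVertex w
  obtain ⟨T₁, h₁⟩ := exists_areJoined_spanOn X hS hH
  obtain ⟨T₂, h₂⟩ := exists_areJoined_spanOn X hS hK
  have ⟨_, hT₁, _⟩ := h₁
  have ⟨_, hT₂, _⟩ := h₂
  have ⟨_, _, hreach⟩ := (h₁.trans (areJoined_spanOn hS hT₁ hT₂)).trans h₂.symm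
  exact hreach

end Assembly

end FreeFactorComplex

open FreeFactorComplex in
theorem mainTheorem5_general {F ι : Type*} [Group F] [Finite ι] (X : FreeGroupBasis ι F)
    (A : Subgroup F) (k : ℕ) (hA : HasCorank A k) (hk : 3 ≤ k) :
    IsConnectedComplex (upwardLink A) := by
  obtain ⟨B, hAB, ⟨e⟩⟩ := hA
  have := X.isFreeGroup
  let Y := internalFreeProductBasis hAB (IsFreeGroup.basis A) (FreeGroupBasis.ofRepr e.symm)
  have : Finite (IsFreeGroup.Generators A ⊕ Fin k) :=
    .of_equiv ι (Equiv.ofFreeGroupEquiv (X.repr.symm.trans Y.repr))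
  have hspan : spanOn Y (Set.range Sum.inl) = A := spanOn_internalFreeProductBasis hAB _ _
  rw [← hspan]
  apply isConnectedComplex_upwardLink_spanOn
  rw [Set.compl_range_inl, ← Set.image_univ, Sum.inr_injective.encard_image, Set.encard_univ,
    ENat.card_eq_coe_fintype_card, Fintype.card_fin]
  exact_mod_cast hk

theorem mainTheorem5 (n : ℕ) (A : Subgroup (FreeGroup (Fin n))) (k : ℕ)
    (hA : HasCorank A k) (hk : 3 ≤ k) :
    IsConnectedComplex (upwardLink A) :=
  mainTheorem5_general (FreeGroupBasis.ofFreeGroup (Fin n)) A k hA hk
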